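/- Let $n>p\ge 1$ be integers, let $q,\theta,s\in\mathbb R$ with $\theta>0$, $s>0$, $2q+np>2$, let $\mu\in\mathbb R^p$ and let $\Sigma$ be a symmetric positive definite $p\times p$ real matrix. Let $X_1,\dots,X_n$ be random vectors in $\mathbb R^p$ with joint density (the multivariate Kotz type model) $$f(x_1,\dots,x_n)=|\Sigma|^{-n/2}\,h\Big(\sum_{i=1}^n (x_i-\mu)'\Sigma^{-1}(x_i-\mu)\Big),\qquad h(z)=\frac{s\,\theta^{\frac{2q+np-2}{2s}}\,\Gamma\!\left(\frac{np}{2}\right)}{\pi^{np/2}\,\Gamma\!\left(\frac{2q+np-2}{2s}\right)}\,z^{q-1}e^{-\theta z^s},$$ and let $A$ be a Kotz–Wishart matrix, that is, a random matrix with the distribution of $\sum_{i=1}^n (X_i-\overline X)(X_i-\overline X)'$, where $\overline X=\frac1n\sum_{i=1}^n X_i$. Then $A$ and $A^2$ are integrable, $$E(A)=\frac{(n-1)\,\theta^{-1/s}\,\Gamma\!\left(\frac{2q+np}{2s}\right)}{np\,\Gamma\!\left(\frac{2q+np-2}{2s}\right)}\,\Sigma ,$$ and, for every random matrix $W$ with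 the Wishart distribution $W_p(n-1,\Sigma)$ (the distribution of $\sum_{i=1}^{n-1}Y_iY_i'$ with $Y_1,\dots,Y_{n-1}$ independent $\mathcal N_p(0,\Sigma)$ vectors), $W^2$ is integrable, $$E(A^2)=\frac{\theta^{-2/s}\,\Gamma\!\left(\frac{2q+np+2}{2s}\right)}{np(np+2)\,\Gamma\!\left(\frac{2q+np-2}{2s}\right)}\,E(W^2)\qquad\text{and}\qquad E(W^2)=(n-1)^2\Sigma^2+(n-1)\big[\Sigma\,\mathrm{tr}(\Sigma)+\Sigma^2\big].$$ -/

import Mathlib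

open MeasureTheory ProbabilityTheory Matrix

noncomputable section

namespace KotzWishart

/-- The density generator
`h(z) = s θ^((2q+N-2)/(2s)) Γ(N/2) / (π^(N/2) Γ((2q+N-2)/(2s))) * z^(q-1) * exp(-θ z^s)`
of the Kotz type distribution in total dimension `N`. -/
def kotzGenerator (N : ℕ) (q θ s z : ℝ) : ℝ :=
  s * θ ^ ((2 * q + N - 2) / (2 * s)) * Real.Gamma ((N : ℝ) / 2) /
      (Real.pi ^ ((N : ℝ) / 2) * Real.Gamma ((2 * q + N - 2) / (2 * s))) *
    (z ^ (q - 1) * Real.exp (-θ * z ^ s))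

/-- The joint density of `n` vectors of dimension `p` in the multivariate Kotz type model with
location `m` and scale matrix `S`:
`|S|^(-n/2) * h (∑ i, (x i - m)' S⁻¹ (x i - m))`. -/
def kotzDensity (n p : ℕ) (q θ s : ℝ) (m : Fin p → ℝ) (S : Matrix (Fin p) (Fin p) ℝ)
    (x : Fin n → Fin p → ℝ) : ℝ :=
  S.det ^ (-((n : ℝ) / 2)) *
    kotzGenerator (n * p) q θ s (∑ i, (x i - m) ⬝ᵥ (S⁻¹ *ᵥ (x i - m)))

/-- The joint law of the sample in the multivariate Kotz type model. -/
def kotzModel (n p : ℕ) (q θ s : ℝ) (m : Fin p → ℝ) (S : Matrix (Fin p) (Fin p) ℝ) :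
    Measure (Fin n → Fin p → ℝ) :=
  (volume : Measure (Fin n → Fin p → ℝ)).withDensity
    (fun x => ENNReal.ofReal (kotzDensity n p q θ s m S x))

/-- The sample mean. -/
def sampleMean {n p : ℕ} (x : Fin n → Fin p → ℝ) : Fin p → ℝ :=
  (n : ℝ)⁻¹ • ∑ i, x i

/-- The matrix of sums of squares and products about the sample mean,
`∑ i, (x i - x̄) (x i - x̄)'`. -/
def sspMatrix {n p : ℕ} (x : Fin n → Fin p → ℝ) : Matrix (Fin p) (Fin p) ℝ :=
  ∑ i, vecMulVec (x i - sampleMean x) (x i - sampleMean x)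

/-- Real matrices carry the product (Borel) σ-algebra of their entries. -/
instance instMeasurableSpaceMatrix (a b : Type*) : MeasurableSpace (Matrix a b ℝ) :=
  inferInstanceAs (MeasurableSpace (a → b → ℝ))

/-- The Kotz–Wishart distribution `KW_p(n-1, S)`: the law of the matrix of sums of squares and
products about the sample mean, formed from the multivariate Kotz type model. -/
def kotzWishart (n p : ℕ) (q θ s : ℝ) (m : Fin p → ℝ) (S : Matrix (Fin p) (Fin p) ℝ) :
    Measure (Matrix (Fin p) (Fin p) ℝ) :=
  (kotzModel n p q θ s m S).map sspMatrix

/-- The sum of outer products `∑ i, y i (y i)'`. -/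
def sumOuter {k p : ℕ} (y : Fin k → EuclideanSpace ℝ (Fin p)) : Matrix (Fin p) (Fin p) ℝ :=
  ∑ i, vecMulVec (y i).ofLp (y i).ofLp

/-- The Wishart distribution `W_p(k, S)`: the law of `∑ i, y i (y i)'`, where `y 1, …, y k` are
independent centred Gaussian vectors with covariance matrix `S`. -/
def wishart (p k : ℕ) (S : Matrix (Fin p) (Fin p) ℝ) : Measure (Matrix (Fin p) (Fin p) ℝ) :=
  (Measure.pi (fun _ : Fin k => multivariateGaussian 0 S)).map sumOuter

/-- The matrices whose laws are taken above are measurable functions of the sample. -/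
theorem measurable_sspMatrix {n p : ℕ} : Measurable (sspMatrix (n := n) (p := p)) := by
  refine measurable_pi_lambda _ fun a => measurable_pi_lambda _ fun b => ?_
  simp only [sspMatrix, sampleMean, Matrix.sum_apply, vecMulVec_apply, Pi.sub_apply,
    Pi.smul_apply, Finset.sum_apply, smul_eq_mul]
  fun_prop

theorem measurable_sumOuter {k p : ℕ} : Measurable (sumOuter (k := k) (p := p)) := by
  refine measurable_pi_lambda _ fun a => measurable_pi_lambda _ fun b => ?_
  simp only [sumOuter, Matrix.sum_apply, vecMulVec_apply]
  fun_prop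

/-- A random matrix is integrable if all its entries are. -/
def IntegrableMatrix {Ω : Type*} [MeasurableSpace Ω] {p : ℕ}
    (M : Ω → Matrix (Fin p) (Fin p) ℝ) (P : Measure Ω) : Prop :=
  ∀ a b, Integrable (fun ω => M ω a b) P

/-- The (entrywise) expectation of a random matrix. -/
def expectation {Ω : Type*} [MeasurableSpace Ω] {p : ℕ}
    (M : Ω → Matrix (Fin p) (Fin p) ℝ) (P : Measure Ω) : Matrix (Fin p) (Fin p) ℝ :=
  Matrix.of fun a b => ∫ ω, M ω a b ∂P

end KotzWishart

end

/-! Everything reduces to a comparison with the Gaussian case. Writing Σ = BB' with B invertible,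
the sample is an affine image of a vector z in ℝ^(np) with density C·k(|z|²), k being the Kotz
kernel (`exists_kotzModel_eq_map`). In polar coordinates, the integral of a function homogeneous of
degree k against such a density is a sphere integral, the same for every kernel, times a radial
integral given by a Gamma function. The standard Gaussian is itself of this type, with q = 1, θ =
1/2, s = 1 (`stdGaussian_eq_withDensity`). Hence Kotz and Gaussian expectations of homogeneous
functions differ only by a quotient of radial moments (`integral_kotz_eq_mul_integral_stdGaussian`).

The entries of the matrix about the sample mean are homogeneous of degree 2 in z, those of its
square of degree 4, which gives the Gamma factors over np and np(np+2). The Gaussian expectations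
come from Isserlis' theorem: for rows with covariance M ⊗ Σ they depend on M only through tr M and
tr M'M (`expectation_gramSum_sq`). The centring matrix is a symmetric idempotent of trace n-1, so
both traces agree with those of the identity of order n-1, the Wishart case. No distributional
identity between the two Gaussian matrices is needed. -/

noncomputable section

namespace KotzWishart

/-! ### Radial integrals of the Kotz kernel. -/

/-- The unnormalised Kotz density generator. -/
def kotzKernel (q θ s z : ℝ) : ℝ := z ^ (q - 1) * Real.exp (-θ * z ^ s)

/-- The integral of `r ^ (N - 1 + k) * kotzKernel q θ s (r ^ 2)` over the positive half-line, as a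
function of `d = N + k`. -/
def radialMoment (q θ s d : ℝ) : ℝ :=
  θ ^ (-(2 * q + d - 2) / (2 * s)) * (1 / (2 * s)) * Real.Gamma ((2 * q + d - 2) / (2 * s))

theorem kotzKernel_nonneg {q θ s z : ℝ} (hz : 0 ≤ z) : 0 ≤ kotzKernel q θ s z :=
  mul_nonneg (Real.rpow_nonneg hz _) (Real.exp_pos _).le

theorem measurable_kotzKernel (q θ s : ℝ) : Measurable (kotzKernel q θ s) := by
  unfold kotzKernel
  fun_prop

theorem radialMoment_pos {q θ s d : ℝ} (hθ : 0 < θ) (hs : 0 < s) (hd : 2 < 2 * q + d) :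
    0 < radialMoment q θ s d := by
  have : 0 < (2 * q + d - 2) / (2 * s) := by
    apply div_pos <;> linarith
  have := Real.Gamma_pos_of_pos this
  unfold radialMoment
  positivity

theorem pow_mul_kotzKernel_sq {q θ s r : ℝ} (hr : 0 < r) (m : ℕ) :
    r ^ m * kotzKernel q θ s (r ^ 2) =
      r ^ ((m : ℝ) + 2 * q - 2) * Real.exp (-θ * r ^ (2 * s)) := by
  have h2 : ∀ t : ℝ, (r ^ 2) ^ t = r ^ (2 * t) := fun t => by
    rw [Real.rpow_mul hr.le, Real.rpow_two]
  rw [kotzKernel, h2, h2, ← mul_assoc, ← Real.rpow_natCast r m, ← Real.rpow_add hr]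
  congr 2
  ring

theorem integrableOn_pow_mul_kotzKernel {q θ s : ℝ} (hθ : 0 < θ) (hs : 0 < s) (m : ℕ)
    (hm : 1 < 2 * q + m) :
    IntegrableOn (fun r : ℝ => r ^ m * kotzKernel q θ s (r ^ 2)) (Set.Ioi 0) :=
  (integrableOn_rpow_mul_exp_neg_mul_rpow (s := (m : ℝ) + 2 * q - 2) (p := 2 * s)
    (by linarith) (by positivity) hθ).congr_fun
    (fun _ hr => (pow_mul_kotzKernel_sq hr m).symm) measurableSet_Ioi

theorem integral_pow_mul_kotzKernel {q θ s : ℝ} (hθ : 0 < θ) (hs : 0 < s) (m : ℕ)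
    (hm : 1 < 2 * q + m) :
    ∫ r in Set.Ioi (0 : ℝ), r ^ m * kotzKernel q θ s (r ^ 2) = radialMoment q θ s (m + 1) := by
  rw [setIntegral_congr_fun measurableSet_Ioi (fun _ hr => pow_mul_kotzKernel_sq hr m),
    integral_rpow_mul_exp_neg_mul_rpow (by positivity) (by linarith) hθ, radialMoment]
  congr 3 <;> ring

/-! ### Polar coordinates and homogeneous functions. -/

section Polar

variable {E : Type*} [NormedAddCommGroup E] [NormedSpace ℝ E] [FiniteDimensional ℝ E]
  [Nontrivial E] [MeasurableSpace E] [BorelSpace E] (μ : Measure E) [μ.IsAddHaarMeasure]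

/-- Polar coordinates for the product of a homogeneous function with a radial function. -/
theorem integral_homogeneous_mul_radial {F : E → ℝ} (hF : Continuous F) (k : ℕ)
    (hk : ∀ (r : ℝ) z, F (r • z) = r ^ k * F z) {g : ℝ → ℝ}
    (hg : IntegrableOn (fun r : ℝ => r ^ (Module.finrank ℝ E - 1 + k) * g r) (Set.Ioi 0)) :
    Integrable (fun z => F z * g ‖z‖) μ ∧
      ∫ z, F z * g ‖z‖ ∂μ = (∫ u, F u ∂μ.toSphere) *
        ∫ r in Set.Ioi (0 : ℝ), r ^ (Module.finrank ℝ E - 1 + k) * g r := by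
  set d := Module.finrank ℝ E - 1 with hd
  -- Homogeneity turns the integrand into a product of a function of the direction and a function of
  -- the radius, so Fubini applies on sphere × half-line.
  set G : Metric.sphere (0 : E) 1 × Set.Ioi (0 : ℝ) → ℝ := fun x => F x.1 * (x.2.1 ^ k * g x.2)
    with hG
  have hmp := μ.measurePreserving_homeomorphUnitSphereProd
  have hcomp : ∀ x : ({(0)}ᶜ : Set E), F x * g ‖x.1‖ = G (homeomorphUnitSphereProd E x) := by
    intro x
    have hx : ‖x.1‖ ≠ 0 := norm_ne_zero_iff.2 x.2
    simp only [hG, homeomorphUnitSphereProd_apply_snd_coe, homeomorphUnitSphereProd_apply_fst_coe]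
    have hFx : F x = ‖x.1‖ ^ k * F (‖x.1‖⁻¹ • x.1) := by
      rw [← hk, smul_smul, mul_inv_cancel₀ hx, one_smul]
    rw [hFx]
    ring
  have hdens : ∀ r : Set.Ioi (0 : ℝ),
      (ENNReal.ofReal (r.1 ^ d)).toReal • (r.1 ^ k * g r) = r.1 ^ (d + k) * g r := by
    intro r
    have : 0 ≤ r.1 ^ d := pow_nonneg (le_of_lt r.2) d
    rw [ENNReal.toReal_ofReal this, smul_eq_mul, ← mul_assoc, pow_add]
  have hradial : Integrable (fun r : Set.Ioi (0 : ℝ) => r.1 ^ k * g r)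
      (Measure.volumeIoiPow d) := by
    rw [Measure.volumeIoiPow, integrable_withDensity_iff_integrable_smul' (by fun_prop) (by simp)]
    simp_rw [hdens]
    exact (integrableOn_iff_comap_subtypeVal measurableSet_Ioi).1 hg
  have hsphere : Integrable (fun u : Metric.sphere (0 : E) 1 => F u) μ.toSphere :=
    (hF.comp continuous_subtype_val).integrable_of_hasCompactSupport
      (HasCompactSupport.of_compactSpace _)
  constructor
  · rw [← restrict_compl_singleton (μ := μ) 0, ← IntegrableOn,
      integrableOn_iff_comap_subtypeVal (measurableSet_singleton _).compl]
    have h := (hmp.integrable_comp_emb (Homeomorph.measurableEmbedding _)).2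
      (hsphere.mul_prod hradial)
    exact h.congr (.of_forall fun x => (hcomp x).symm)
  · calc ∫ z, F z * g ‖z‖ ∂μ
        = ∫ x : ({(0)}ᶜ : Set E), F x * g ‖x.1‖ ∂(μ.comap (↑)) := by
          rw [integral_subtype_comap (measurableSet_singleton _).compl
            fun x => F x * g ‖x‖, restrict_compl_singleton]
      _ = ∫ x, G x ∂μ.toSphere.prod (.volumeIoiPow d) := by
          simp_rw [hcomp]
          exact hmp.integral_comp (Homeomorph.measurableEmbedding _) G
      _ = (∫ u, F u ∂μ.toSphere) * ∫ r : Set.Ioi (0 : ℝ), r.1 ^ k * g r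
            ∂.volumeIoiPow d := integral_prod_mul (fun u : Metric.sphere (0 : E) 1 => F u)
            fun r : Set.Ioi (0 : ℝ) => r.1 ^ k * g r
      _ = _ := by
          congr 1
          rw [Measure.volumeIoiPow, integral_withDensity_eq_integral_toReal_smul (by fun_prop)
            (by simp)]
          simp_rw [hdens]
          exact integral_subtype_comap measurableSet_Ioi fun r => r ^ (d + k) * g r

theorem integral_homogeneous_mul_kotzKernel {q θ s : ℝ} (hθ : 0 < θ) (hs : 0 < s)
    (hq : 2 < 2 * q + Module.finrank ℝ E) {F : E → ℝ} (hF : Continuous F) (k : ℕ)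
    (hk : ∀ (r : ℝ) z, F (r • z) = r ^ k * F z) :
    Integrable (fun z => F z * kotzKernel q θ s (‖z‖ ^ 2)) μ ∧
      ∫ z, F z * kotzKernel q θ s (‖z‖ ^ 2) ∂μ =
        (∫ u, F u ∂μ.toSphere) * radialMoment q θ s (Module.finrank ℝ E + k) := by
  have hpos : 0 < Module.finrank ℝ E := Module.finrank_pos
  have hcast : ((Module.finrank ℝ E - 1 + k : ℕ) : ℝ) + 1 = Module.finrank ℝ E + k := by
    push_cast [Nat.cast_sub (Nat.one_le_iff_ne_zero.2 hpos.ne')]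
    ring
  have hm : 1 < 2 * q + ((Module.finrank ℝ E - 1 + k : ℕ) : ℝ) := by
    have : (0 : ℝ) ≤ k := k.cast_nonneg
    linarith
  have h := integral_homogeneous_mul_radial μ hF k hk (g := fun r => kotzKernel q θ s (r ^ 2))
    (integrableOn_pow_mul_kotzKernel hθ hs _ hm)
  rwa [integral_pow_mul_kotzKernel hθ hs _ hm, hcast] at h

/-- Moments of homogeneous functions under a probability measure with a Kotz type density. -/
theorem integral_homogeneous_of_kotz {q θ s C : ℝ} (hθ : 0 < θ) (hs : 0 < s) (hC : 0 ≤ C)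
    (hq : 2 < 2 * q + Module.finrank ℝ E)
    (hprob : IsProbabilityMeasure
      (μ.withDensity fun z => ENNReal.ofReal (C * kotzKernel q θ s (‖z‖ ^ 2))))
    {F : E → ℝ} (hF : Continuous F) (k : ℕ) (hk : ∀ (r : ℝ) z, F (r • z) = r ^ k * F z) :
    Integrable F (μ.withDensity fun z => ENNReal.ofReal (C * kotzKernel q θ s (‖z‖ ^ 2))) ∧
      ∫ z, F z ∂(μ.withDensity fun z => ENNReal.ofReal (C * kotzKernel q θ s (‖z‖ ^ 2))) =
        (∫ u, F u ∂μ.toSphere) / μ.toSphere.real Set.univ *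
          (radialMoment q θ s (Module.finrank ℝ E + k) /
            radialMoment q θ s (Module.finrank ℝ E)) := by
  have key : ∀ {F : E → ℝ}, Continuous F → ∀ k : ℕ, (∀ (r : ℝ) z, F (r • z) = r ^ k * F z) →
      Integrable F (μ.withDensity fun z => ENNReal.ofReal (C * kotzKernel q θ s (‖z‖ ^ 2))) ∧
      ∫ z, F z ∂(μ.withDensity fun z => ENNReal.ofReal (C * kotzKernel q θ s (‖z‖ ^ 2))) =
        C * ((∫ u, F u ∂μ.toSphere) * radialMoment q θ s (Module.finrank ℝ E + k)) := by
    intro F hF k hk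
    obtain ⟨h1, h2⟩ := integral_homogeneous_mul_kotzKernel μ hθ hs hq hF k hk
    have hmeas : Measurable fun z : E => ENNReal.ofReal (C * kotzKernel q θ s (‖z‖ ^ 2)) := by
      have := measurable_kotzKernel q θ s
      fun_prop
    have heq : ∀ z : E, (ENNReal.ofReal (C * kotzKernel q θ s (‖z‖ ^ 2))).toReal • F z =
        C * (F z * kotzKernel q θ s (‖z‖ ^ 2)) := fun z => by
      rw [ENNReal.toReal_ofReal (mul_nonneg hC (kotzKernel_nonneg (sq_nonneg _))), smul_eq_mul]
      ring
    rw [integrable_withDensity_iff_integrable_smul' hmeas (by simp),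
      integral_withDensity_eq_integral_toReal_smul hmeas (by simp)]
    simp_rw [heq]
    exact ⟨h1.const_mul C, by rw [integral_const_mul, h2]⟩
  refine ⟨(key hF k hk).1, ?_⟩
  rw [(key hF k hk).2]
  -- The constant function, homogeneous of degree 0, turns total mass 1 into an equation that
  -- determines C; no explicit normalising constant is used.
  have h1 := (key (F := fun _ => 1) continuous_const 0 (by simp)).2
  simp only [integral_const, probReal_univ, smul_eq_mul, mul_one, Nat.cast_zero, add_zero] at h1
  have hR := (radialMoment_pos hθ hs hq).ne'
  have hS : μ.toSphere.real Set.univ ≠ 0 := fun h => by simp [h] at h1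
  have hCeq : C = 1 / (μ.toSphere.real Set.univ * radialMoment q θ s (Module.finrank ℝ E)) := by
    field_simp
    linarith
  rw [hCeq]
  field_simp

end Polar

/-! ### The standard Gaussian as a Kotz type law. -/

section StdGaussian

variable (E : Type*) [NormedAddCommGroup E] [InnerProductSpace ℝ E] [FiniteDimensional ℝ E]
  [MeasurableSpace E] [BorelSpace E]

/-- The standard Gaussian measure has a Kotz type density. -/
theorem stdGaussian_eq_withDensity :
    stdGaussian E = (volume : Measure E).withDensity fun z =>
      ENNReal.ofReal ((2 * Real.pi) ^ (-(Module.finrank ℝ E / 2 : ℝ)) *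
        kotzKernel 1 (1 / 2) 1 (‖z‖ ^ 2)) := by
  set C : ℝ := (2 * Real.pi) ^ (-(Module.finrank ℝ E / 2 : ℝ)) with hC
  have hC0 : 0 < C := by positivity
  have hker : ∀ z : E, C * kotzKernel 1 (1 / 2) 1 (‖z‖ ^ 2) =
      C * Real.exp (-(1 / 2) * ‖z‖ ^ 2) := fun z => by simp [kotzKernel]
  simp_rw [hker]
  have hexp : ∀ z : E, ((Real.exp (-(1 / 2) * ‖z‖ ^ 2) : ℝ) : ℂ) =
      Complex.exp (-(1 / 2) * ‖z‖ ^ 2) := fun z => by push_cast; rfl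
  have hb : 0 < (1 / 2 : ℂ).re := by norm_num
  have hint : Integrable (fun z : E => C * Real.exp (-(1 / 2) * ‖z‖ ^ 2)) := by
    have := (GaussianFourier.integrable_cexp_neg_mul_sq_norm_add hb 0 (0 : E)).norm
    refine (this.congr (.of_forall fun z => ?_)).const_mul C
    simp only [zero_mul, add_zero, ← hexp, Complex.norm_real, Real.norm_eq_abs, Real.abs_exp]
  have : IsFiniteMeasure ((volume : Measure E).withDensity fun z =>
      ENNReal.ofReal (C * Real.exp (-(1 / 2) * ‖z‖ ^ 2))) :=
    isFiniteMeasure_withDensity_ofReal hint.2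
  -- Both measures are finite, so it is enough to match characteristic functions; that of the
  -- density is a Gaussian Fourier integral.
  refine Measure.ext_of_charFun (funext fun t => ?_)
  rw [charFun_stdGaussian, charFun_apply, integral_withDensity_eq_integral_toReal_smul
    (by fun_prop) (by simp)]
  have hpt : ∀ z : E, (ENNReal.ofReal (C * Real.exp (-(1 / 2) * ‖z‖ ^ 2))).toReal •
      Complex.exp (inner ℝ z t * Complex.I) =
      (C : ℂ) * Complex.exp (-(1 / 2) * ‖z‖ ^ 2 + Complex.I * inner ℝ t z) := fun z => by
    rw [ENNReal.toReal_ofReal (by positivity), Complex.real_smul, Complex.ofReal_mul, hexp,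
      mul_assoc, ← Complex.exp_add, real_inner_comm, mul_comm Complex.I]
  simp_rw [hpt]
  rw [integral_const_mul, GaussianFourier.integral_cexp_neg_mul_sq_norm_add hb]
  have hone : (C : ℂ) * (Real.pi / (1 / 2) : ℂ) ^ (Module.finrank ℝ E / 2 : ℂ) = 1 := by
    have : (Real.pi / (1 / 2) : ℂ) ^ (Module.finrank ℝ E / 2 : ℂ) =
        (((2 * Real.pi) ^ (Module.finrank ℝ E / 2 : ℝ) : ℝ) : ℂ) := by
      rw [Complex.ofReal_cpow (by positivity)]
      push_cast
      congr 1
      ring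
    rw [this, ← Complex.ofReal_mul, hC, ← Real.rpow_add (by positivity)]
    simp
  rw [← mul_assoc, hone, one_mul]
  congr 1
  rw [Complex.I_sq]
  ring

end StdGaussian

/-! ### Fourth moments of Gaussian vectors. -/

theorem integral_pow_four_gaussianReal (v : NNReal) :
    ∫ x, x ^ 4 ∂gaussianReal 0 v = 3 * (v : ℝ) ^ 2 := by
  have h : ∫ x, x ^ 4 ∂gaussianReal 0 v =
      iteratedDeriv 4 (mgf (fun x => x) (gaussianReal 0 v)) 0 := by
    rw [iteratedDeriv_mgf_zero] <;> simp
  -- Differentiation preserves the form p(t)·exp(vt²/2), replacing p by p' + vtp; four applications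
  -- starting from p = 1 give the fourth derivative of the moment generating function.
  have hd : ∀ p p' : ℝ → ℝ, (∀ t, HasDerivAt p (p' t) t) →
      deriv (fun t : ℝ => p t * Real.exp (v * t ^ 2 / 2)) =
        fun t => (p' t + p t * (v * t)) * Real.exp (v * t ^ 2 / 2) := by
    intro p p' hp
    ext t
    have he : HasDerivAt (fun t : ℝ => Real.exp (v * t ^ 2 / 2))
        (Real.exp (v * t ^ 2 / 2) * (v * t)) t := by
      refine HasDerivAt.exp ?_
      convert! (((hasDerivAt_id t).pow 2).const_mul (v : ℝ)).div_const 2 using 1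
      simp
      ring
    refine HasDerivAt.deriv ?_
    convert! (hp t).mul he using 1
    ring
  have h0 : mgf (fun x => x) (gaussianReal 0 v) =
      fun t : ℝ => (fun _ : ℝ => (1 : ℝ)) t * Real.exp (v * t ^ 2 / 2) := by
    rw [mgf_fun_id_gaussianReal]
    simp
  rw [h, h0, iteratedDeriv_succ, iteratedDeriv_succ, iteratedDeriv_succ, iteratedDeriv_one,
    hd _ (fun _ => 0) fun t => hasDerivAt_const t 1,
    hd _ (fun _ => (v : ℝ)) fun t => by
      simpa using (hasDerivAt_id t).const_mul (v : ℝ),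
    hd (fun t => (v : ℝ) + (0 + 1 * (v * t)) * (v * t)) (fun t => 2 * (v : ℝ) ^ 2 * t) fun t => by
      have := ((hasDerivAt_id t).pow 2).const_mul ((v : ℝ) ^ 2)
      convert! this.const_add (v : ℝ) using 1
      · ext t; simp; ring
      · simp; ring,
    hd _ (fun t => 3 * (v : ℝ) ^ 2 + 3 * (v : ℝ) ^ 3 * t ^ 2) fun t => by
      have := (((hasDerivAt_id t).pow 3).const_mul ((v : ℝ) ^ 3)).add
        ((hasDerivAt_id t).const_mul (3 * (v : ℝ) ^ 2))
      convert! this using 1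
      · ext t; simp; ring
      · simp; ring]
  simp

section Isserlis

variable {Ω ι : Type*} [MeasurableSpace Ω] {P : Measure Ω} {X : ι → Ω → ℝ}

theorem integral_pow_four_of_hasGaussianLaw {Y : Ω → ℝ} (hY : HasGaussianLaw Y P)
    (h0 : ∫ ω, Y ω ∂P = 0) : ∫ ω, Y ω ^ 4 ∂P = 3 * (∫ ω, Y ω ^ 2 ∂P) ^ 2 := by
  have := hY.isProbabilityMeasure
  have hvar : Var[Y; P] = ∫ ω, Y ω ^ 2 ∂P := by
    rw [variance_eq_integral hY.aemeasurable, h0]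
    simp
  have hmap := hY.map_eq_gaussianReal
  rw [h0] at hmap
  have h4 := integral_pow_four_gaussianReal Var[Y; P].toNNReal
  rw [← hmap, integral_map hY.aemeasurable (by fun_prop),
    Real.coe_toNNReal _ (variance_nonneg _ _), hvar] at h4
  exact h4

theorem integrable_prod_of_hasGaussianLaw [Finite ι]
    (hX : HasGaussianLaw (fun ω => (X · ω)) P)
    {m : ℕ} (t : Fin m → ι) : Integrable (fun ω => ∏ j, X (t j) ω) P := by
  have := hX.isProbabilityMeasure
  by_cases hm : m = 0
  · subst hm
    simp
  have hm' : (m : ENNReal) ≠ 0 := by exact_mod_cast hm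
  -- Hölder's inequality with m factors, each in L^m, places the product in L¹.
  have h : MemLp (fun ω => ∏ j ∈ Finset.univ, X (t j) ω) (∑ j : Fin m, (m : ENNReal)⁻¹)⁻¹ P :=
    MemLp.prod' (p := fun _ => (m : ENNReal)) fun j _ => (hX.eval (t j)).memLp (by simp)
  simp only [Finset.sum_const, Finset.card_univ, Fintype.card_fin, nsmul_eq_mul,
    ENNReal.mul_inv_cancel hm' (ENNReal.natCast_ne_top m), inv_one] at h
  exact memLp_one_iff_integrable.1 h

/-- Isserlis' theorem for the fourth moments of a centred Gaussian vector. -/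
theorem integral_mul_mul_mul_of_hasGaussianLaw [Fintype ι]
    (hX : HasGaussianLaw (fun ω => (X · ω)) P) (h0 : ∀ i, ∫ ω, X i ω ∂P = 0) (a b c d : ι) :
    ∫ ω, X a ω * X b ω * X c ω * X d ω ∂P =
      (∫ ω, X a ω * X b ω ∂P) * (∫ ω, X c ω * X d ω ∂P) +
      (∫ ω, X a ω * X c ω ∂P) * (∫ ω, X b ω * X d ω ∂P) +
      (∫ ω, X a ω * X d ω ∂P) * (∫ ω, X b ω * X c ω ∂P) := by
  have := hX.isProbabilityMeasure
  have i1 : ∀ i, Integrable (X i) P := fun i => (hX.eval i).integrable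
  have i2 : ∀ i j, Integrable (fun ω => X i ω * X j ω) P := fun i j => by
    simpa [Fin.prod_univ_succ] using integrable_prod_of_hasGaussianLaw hX ![i, j]
  set Y : ℝ → ℝ → ℝ → Ω → ℝ := fun x y z ω => X a ω + x * X b ω + y * X c ω + z * X d ω with hYdef
  have hY : ∀ x y z, HasGaussianLaw (Y x y z) P := fun x y z => by
    have := hX.map_fun (ContinuousLinearMap.proj (R := ℝ) (φ := fun _ : ι => ℝ) a +
      x • ContinuousLinearMap.proj b + y • ContinuousLinearMap.proj c +
      z • ContinuousLinearMap.proj d)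
    simpa using this
  have hY0 : ∀ x y z, ∫ ω, Y x y z ω ∂P = 0 := fun x y z => by
    simp only [hYdef]
    rw [integral_add, integral_add, integral_add]
    · simp [integral_const_mul, h0]
    all_goals
      repeat' apply Integrable.add
      all_goals first | exact i1 _ | exact (i1 _).const_mul _
  have hY4 : ∀ x y z, Integrable (fun ω => Y x y z ω ^ 4) P := fun x y z => by
    -- A one-element index set lets the bound for products of coordinates apply to the fourth power
    -- of a single variable.
    have h : HasGaussianLaw (fun ω => ((fun _ : Unit => Y x y z) · ω)) P :=
      (hY x y z).map_fun (ContinuousLinearMap.pi fun _ : Unit => ContinuousLinearMap.id ℝ ℝ)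
    simpa using integrable_prod_of_hasGaussianLaw h fun _ : Fin 4 => ()
  have hY2 : ∀ x y z, ∫ ω, Y x y z ω ^ 2 ∂P =
      (∫ ω, X a ω * X a ω ∂P) + x ^ 2 * (∫ ω, X b ω * X b ω ∂P) + y ^ 2 * (∫ ω, X c ω * X c ω ∂P) +
      z ^ 2 * (∫ ω, X d ω * X d ω ∂P) + 2 * x * (∫ ω, X a ω * X b ω ∂P) +
      2 * y * (∫ ω, X a ω * X c ω ∂P) + 2 * z * (∫ ω, X a ω * X d ω ∂P) +
      2 * x * y * (∫ ω, X b ω * X c ω ∂P) + 2 * x * z * (∫ ω, X b ω * X d ω ∂P) +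
      2 * y * z * (∫ ω, X c ω * X d ω ∂P) := fun x y z => by
    simp_rw [← integral_const_mul]
    rw [← integral_add, ← integral_add, ← integral_add, ← integral_add, ← integral_add,
      ← integral_add, ← integral_add, ← integral_add, ← integral_add]
    · congr with ω
      simp only [hYdef]
      ring
    all_goals
      repeat' apply Integrable.add
      all_goals first | exact i2 _ _ | exact (i2 _ _).const_mul _
  -- Polarisation: the signed sum over the 8 sign choices keeps only monomials odd in each of b, c,
  -- d, hence only abcd, whose coefficient in each fourth power is 4! = 24; this gives 192 = 8·24.
  have hpol : ∀ ω, X a ω * X b ω * X c ω * X d ω = 1 / 192 *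
      (Y 1 1 1 ω ^ 4 - Y 1 1 (-1) ω ^ 4 - Y 1 (-1) 1 ω ^ 4 + Y 1 (-1) (-1) ω ^ 4 -
        Y (-1) 1 1 ω ^ 4 + Y (-1) 1 (-1) ω ^ 4 + Y (-1) (-1) 1 ω ^ 4 -
        Y (-1) (-1) (-1) ω ^ 4) := fun ω => by
    simp only [hYdef]
    ring
  simp_rw [hpol]
  rw [integral_const_mul, integral_sub, integral_add, integral_add, integral_sub, integral_add,
    integral_sub, integral_sub]
  · simp_rw [fun x y z => integral_pow_four_of_hasGaussianLaw (hY x y z) (hY0 x y z), hY2]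
    ring
  all_goals
    repeat' first | exact hY4 _ _ _ | apply Integrable.sub | apply Integrable.add

end Isserlis

/-! ### Moments of Gram sums with covariance M ⊗ S. -/

/-- The sum of the outer products of the rows of a family of real random variables. -/
def gramSum {Ω : Type*} {k p : ℕ} (X : Fin k → Fin p → Ω → ℝ) (ω : Ω) :
    Matrix (Fin p) (Fin p) ℝ :=
  ∑ i, vecMulVec (fun a => X i a ω) (fun a => X i a ω)

theorem gramSum_apply {Ω : Type*} {k p : ℕ} (X : Fin k → Fin p → Ω → ℝ) (ω : Ω) (a b : Fin p) :
    gramSum X ω a b = ∑ i, X i a ω * X i b ω := by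
  simp [gramSum, Matrix.sum_apply, vecMulVec_apply]

theorem gramSum_sq_apply {Ω : Type*} {k p : ℕ} (X : Fin k → Fin p → Ω → ℝ) (ω : Ω)
    (a b : Fin p) :
    (gramSum X ω ^ 2) a b =
      ∑ c, ∑ i, ∑ j, X i a ω * X i c ω * X j c ω * X j b ω := by
  rw [sq, Matrix.mul_apply]
  refine Finset.sum_congr rfl fun c _ => ?_
  rw [gramSum_apply, gramSum_apply, Finset.sum_mul_sum]
  simp_rw [mul_assoc]

section Moments

variable {Ω : Type*} [MeasurableSpace Ω] {P : Measure Ω} {k p : ℕ} {X : Fin k → Fin p → Ω → ℝ}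
  {M : Matrix (Fin k) (Fin k) ℝ} {S : Matrix (Fin p) (Fin p) ℝ}

theorem integrable_mul_mul_mul
    (hX : HasGaussianLaw (fun ω => fun t : Fin k × Fin p => X t.1 t.2 ω) P)
    (i j : Fin k) (a b c : Fin p) :
    Integrable (fun ω => X i a ω * X i c ω * X j c ω * X j b ω) P := by
  have := integrable_prod_of_hasGaussianLaw
    (X := fun t : Fin k × Fin p => X t.1 t.2) hX ![(i, a), (i, c), (j, c), (j, b)]
  simpa [Fin.prod_univ_succ, mul_assoc] using this

theorem integrable_gramSum_sq
    (hX : HasGaussianLaw (fun ω => fun t : Fin k × Fin p => X t.1 t.2 ω) P) :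
    IntegrableMatrix (fun ω => gramSum X ω ^ 2) P := fun a b => by
  simp_rw [gramSum_sq_apply]
  exact integrable_finsetSum _ fun c _ => integrable_finsetSum _ fun i _ =>
    integrable_finsetSum _ fun j _ => integrable_mul_mul_mul hX i j a b c

theorem expectation_gramSum
    (hX : HasGaussianLaw (fun ω => fun t : Fin k × Fin p => X t.1 t.2 ω) P)
    (hcov : ∀ i j a b, ∫ ω, X i a ω * X j b ω ∂P = M i j * S a b) :
    expectation (gramSum X) P = M.trace • S := by
  ext a b
  simp only [expectation, of_apply, gramSum_apply, Matrix.smul_apply, smul_eq_mul,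
    trace, diag_apply, Finset.sum_mul]
  rw [integral_finsetSum]
  · simp_rw [hcov]
  · intro i _
    simpa [Fin.prod_univ_succ] using integrable_prod_of_hasGaussianLaw
      (X := fun t : Fin k × Fin p => X t.1 t.2) hX ![(i, a), (i, b)]

/-- Of the three Isserlis pairings, the one within rows contributes M i i · M j j and yields the
term in (tr M)². The two across rows both contribute (M i j)², hence tr MᵀM, with S² in one case and
(tr S)·S in the other. -/
theorem expectation_gramSum_sq
    (hX : HasGaussianLaw (fun ω => fun t : Fin k × Fin p => X t.1 t.2 ω) P)
    (h0 : ∀ i a, ∫ ω, X i a ω ∂P = 0)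
    (hcov : ∀ i j a b, ∫ ω, X i a ω * X j b ω ∂P = M i j * S a b) :
    expectation (fun ω => gramSum X ω ^ 2) P =
      M.trace ^ 2 • S ^ 2 + (Mᵀ * M).trace • (S.trace • S + S ^ 2) := by
  ext a b
  have hI := fun i j c => integral_mul_mul_mul_of_hasGaussianLaw
    (X := fun t : Fin k × Fin p => X t.1 t.2) hX (fun t => h0 t.1 t.2) (i, a) (i, c) (j, c) (j, b)
  simp only [hcov] at hI
  simp only [expectation, of_apply, gramSum_sq_apply]
  rw [integral_finsetSum _ fun c _ => integrable_finsetSum _ fun i _ =>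
    integrable_finsetSum _ fun j _ => integrable_mul_mul_mul hX i j a b c]
  have hc : ∀ c, ∫ ω, ∑ i, ∑ j, X i a ω * X i c ω * X j c ω * X j b ω ∂P =
      M.trace ^ 2 * (S a c * S c b) + (Mᵀ * M).trace * (S c c * S a b + S a c * S c b) := by
    intro c
    rw [integral_finsetSum _ fun i _ =>
      integrable_finsetSum _ fun j _ => integrable_mul_mul_mul hX i j a b c]
    simp_rw [fun i => integral_finsetSum (μ := P) Finset.univ
      fun j (_ : j ∈ Finset.univ) => integrable_mul_mul_mul hX i j a b c, hI]
    have h1 : M.trace ^ 2 = ∑ i, ∑ j, M i i * M j j := by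
      rw [sq, trace, Finset.sum_mul_sum]
      rfl
    have h2 : (Mᵀ * M).trace = ∑ i, ∑ j, M i j * M i j := by
      rw [Finset.sum_comm]
      simp [trace, Matrix.mul_apply]
    rw [h1, h2]
    simp only [Finset.sum_mul, ← Finset.sum_add_distrib]
    refine Finset.sum_congr rfl fun i _ => Finset.sum_congr rfl fun j _ => ?_
    ring
  have hsq : (S ^ 2) a b = ∑ c, S a c * S c b := by rw [sq, Matrix.mul_apply]
  simp only [hc, Matrix.add_apply, Matrix.smul_apply, smul_eq_mul, hsq]
  rw [Finset.sum_add_distrib, ← Finset.mul_sum, ← Finset.mul_sum, Finset.sum_add_distrib,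
    ← Finset.sum_mul]
  rfl

end Moments

/-! ### Passing from a law to a concrete representation. -/

section Transfer

variable {Ω Ω' : Type*} [MeasurableSpace Ω] [MeasurableSpace Ω'] {P : Measure Ω}
  {ν : Measure Ω'} {p : ℕ} {A : Ω → Matrix (Fin p) (Fin p) ℝ} {T : Ω' → Matrix (Fin p) (Fin p) ℝ}

theorem measurable_entry (a b : Fin p) :
    Measurable fun M : Matrix (Fin p) (Fin p) ℝ => M a b :=
  (measurable_pi_apply b).comp (measurable_pi_apply a)

theorem measurable_sq_entry (a b : Fin p) :
    Measurable fun M : Matrix (Fin p) (Fin p) ℝ => (M ^ 2) a b := by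
  simp_rw [sq, Matrix.mul_apply]
  exact Finset.measurable_sum _ fun c _ => (measurable_entry a c).mul (measurable_entry c b)

theorem integrableMatrix_of_hasLaw (hA : HasLaw A (ν.map T) P) (hT : Measurable T)
    {G : Matrix (Fin p) (Fin p) ℝ → Matrix (Fin p) (Fin p) ℝ}
    (hG : ∀ a b, Measurable fun M => G M a b) (h : IntegrableMatrix (fun ω => G (T ω)) ν) :
    IntegrableMatrix (fun ω => G (A ω)) P := fun a b => by
  have h1 := (integrable_map_measure (hG a b).aestronglyMeasurable hT.aemeasurable).2 (h a b)
  rw [← hA.map_eq] at h1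
  exact (integrable_map_measure (hG a b).aestronglyMeasurable hA.aemeasurable).1 h1

theorem expectation_of_hasLaw (hA : HasLaw A (ν.map T) P) (hT : Measurable T)
    {G : Matrix (Fin p) (Fin p) ℝ → Matrix (Fin p) (Fin p) ℝ}
    (hG : ∀ a b, Measurable fun M => G M a b) :
    expectation (fun ω => G (A ω)) P = expectation (fun ω => G (T ω)) ν := by
  ext a b
  simp only [expectation, of_apply]
  rw [← integral_map (φ := T) hT.aemeasurable (hG a b).aestronglyMeasurable, ← hA.map_eq,
    integral_map hA.aemeasurable (hG a b).aestronglyMeasurable]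

end Transfer

/-! ### The Wishart case, M = I. -/

section Wishart

variable {k p : ℕ} {S : Matrix (Fin p) (Fin p) ℝ}

theorem hasGaussianLaw_pi_multivariateGaussian :
    HasGaussianLaw (fun (y : Fin k → EuclideanSpace ℝ (Fin p)) (t : Fin k × Fin p) => y t.1 t.2)
      (Measure.pi fun _ : Fin k => multivariateGaussian 0 S) := by
  have hind : iIndepFun (fun (i : Fin k) (y : Fin k → EuclideanSpace ℝ (Fin p)) => y i)
      (Measure.pi fun _ : Fin k => multivariateGaussian 0 S) :=
    iIndepFun_pi (X := fun _ => id) fun _ => aemeasurable_id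
  have hlaw : ∀ i, HasGaussianLaw (fun y : Fin k → EuclideanSpace ℝ (Fin p) => y i)
      (Measure.pi fun _ : Fin k => multivariateGaussian 0 S) := fun i => by
    have h : HasLaw (fun y : Fin k → EuclideanSpace ℝ (Fin p) => y i) (multivariateGaussian 0 S)
        (Measure.pi fun _ : Fin k => multivariateGaussian 0 S) :=
      (measurePreserving_eval (fun _ : Fin k => multivariateGaussian 0 S) i).hasLaw
    exact h.hasGaussianLaw
  exact (hind.hasGaussianLaw hlaw).map_fun (ContinuousLinearMap.pi fun t : Fin k × Fin p =>
    (EuclideanSpace.proj (𝕜 := ℝ) t.2).comp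
      (ContinuousLinearMap.proj (φ := fun _ : Fin k => EuclideanSpace ℝ (Fin p)) t.1))

theorem integral_eval_multivariateGaussian (a : Fin p) :
    ∫ x, x a ∂multivariateGaussian 0 S = 0 := by
  have := (EuclideanSpace.proj (𝕜 := ℝ) a).integral_comp_id_comm
    (IsGaussian.integrable_id (μ := multivariateGaussian 0 S))
  simpa using this

theorem integral_eval_pi_multivariateGaussian (i : Fin k) (a : Fin p) :
    ∫ y, y i a ∂(Measure.pi fun _ : Fin k => multivariateGaussian 0 S) = 0 := by
  rw [← integral_eval_multivariateGaussian (S := S) a]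
  exact integral_comp_eval (μ := fun _ : Fin k => multivariateGaussian 0 S) (i := i)
    (f := fun x : EuclideanSpace ℝ (Fin p) => x a) (by fun_prop)

theorem integral_mul_pi_multivariateGaussian (hS : S.PosSemidef) (i j : Fin k) (a b : Fin p) :
    ∫ y, y i a * y j b ∂(Measure.pi fun _ : Fin k => multivariateGaussian 0 S) =
      (1 : Matrix (Fin k) (Fin k) ℝ) i j * S a b := by
  by_cases hij : i = j
  · subst hij
    rw [one_apply_eq, one_mul, ← covariance_eval_multivariateGaussian (μ := 0) hS a b, covariance,
      integral_eval_multivariateGaussian, integral_eval_multivariateGaussian]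
    simp only [sub_zero]
    exact integral_comp_eval (μ := fun _ : Fin k => multivariateGaussian 0 S) (i := i)
      (f := fun x : EuclideanSpace ℝ (Fin p) => x a * x b) (by fun_prop)
  · have hind : iIndepFun (fun (i : Fin k) (y : Fin k → EuclideanSpace ℝ (Fin p)) => y i)
        (Measure.pi fun _ : Fin k => multivariateGaussian 0 S) :=
      iIndepFun_pi (X := fun _ => id) fun _ => aemeasurable_id
    have h := (hind.indepFun hij).comp (φ := fun x : EuclideanSpace ℝ (Fin p) => x a)
      (ψ := fun x : EuclideanSpace ℝ (Fin p) => x b) (by fun_prop) (by fun_prop)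
    have h' := h.integral_fun_mul_eq_mul_integral
      (Measurable.aestronglyMeasurable (by fun_prop))
      (Measurable.aestronglyMeasurable (by fun_prop))
    simp only [Function.comp_apply, integral_eval_pi_multivariateGaussian] at h'
    rw [h', one_apply_ne hij]
    simp

theorem moments_of_hasLaw_wishart {Ω : Type*} [MeasurableSpace Ω] {P : Measure Ω}
    {W : Ω → Matrix (Fin p) (Fin p) ℝ} (hS : S.PosSemidef) (hW : HasLaw W (wishart p k S) P) :
    IntegrableMatrix (fun ω => W ω ^ 2) P ∧
      expectation (fun ω => W ω ^ 2) P =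
        (k : ℝ) ^ 2 • S ^ 2 + (k : ℝ) • (S.trace • S + S ^ 2) := by
  have hX := hasGaussianLaw_pi_multivariateGaussian (k := k) (S := S)
  have hT : sumOuter (k := k) (p := p) = gramSum fun i a y => y i a := rfl
  have hM := measurable_sumOuter (k := k) (p := p)
  rw [wishart] at hW
  rw [hT] at hW hM
  refine ⟨integrableMatrix_of_hasLaw (G := fun M => M ^ 2) hW hM measurable_sq_entry
    (integrable_gramSum_sq hX), ?_⟩
  rw [expectation_of_hasLaw (G := fun M => M ^ 2) hW hM measurable_sq_entry,
    expectation_gramSum_sq hX integral_eval_pi_multivariateGaussian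
      (integral_mul_pi_multivariateGaussian hS)]
  simp

end Wishart

/-! ### The centring matrix as a symmetric idempotent. -/

section Centering

/-- The centring matrix `I - J / n`. -/
def centering (n : ℕ) : Matrix (Fin n) (Fin n) ℝ := 1 - of fun _ _ => (n : ℝ)⁻¹

variable {n p : ℕ}

theorem centering_transpose : (centering n)ᵀ = centering n := by
  ext i j
  simp [centering, one_apply, eq_comm]

theorem sum_centering (hn : n ≠ 0) (i : Fin n) : ∑ k, centering n i k = 0 := by
  have : (n : ℝ) ≠ 0 := by exact_mod_cast hn
  simp [centering, one_apply, this]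

theorem centering_mul_self (hn : n ≠ 0) : centering n * centering n = centering n := by
  ext i j
  have h : ∀ k, centering n i k * centering n k j =
      centering n i k * (1 : Matrix (Fin n) (Fin n) ℝ) k j - centering n i k * (n : ℝ)⁻¹ :=
    fun k => by simp [centering, mul_sub]
  rw [Matrix.mul_apply]
  simp_rw [h]
  rw [Finset.sum_sub_distrib, ← Finset.sum_mul, sum_centering hn, ← Matrix.mul_apply]
  simp

theorem trace_centering (hn : n ≠ 0) : (centering n).trace = (n : ℝ) - 1 := by
  have : (n : ℝ) ≠ 0 := by exact_mod_cast hn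
  simp [centering, trace, Finset.sum_sub_distrib, this]

theorem sub_sampleMean_apply (x : Fin n → Fin p → ℝ) (i : Fin n) (a : Fin p) :
    (x i - sampleMean x) a = ∑ k, centering n i k * x k a := by
  simp [sampleMean, centering, sub_mul, one_apply, Finset.sum_sub_distrib, Finset.mul_sum]

theorem sspMatrix_eq_gramSum (x : Fin n → Fin p → ℝ) :
    sspMatrix x = gramSum (fun i a x => ∑ k, centering n i k * x k a) x := by
  simp only [sspMatrix, gramSum]
  refine Finset.sum_congr rfl fun i _ => ?_
  congr 1 <;> exact funext fun a => sub_sampleMean_apply x i a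

end Centering

/-! ### A square root of the scale matrix. -/

section Sqrt

variable {p : ℕ} {S : Matrix (Fin p) (Fin p) ℝ}

open scoped MatrixOrder in
theorem exists_mul_transpose_eq (hS : S.PosDef) :
    ∃ B : Matrix (Fin p) (Fin p) ℝ, B * Bᵀ = S ∧ IsUnit B.det := by
  have h : CFC.sqrt S * CFC.sqrt S = S := CFC.sqrt_mul_sqrt_self S hS.posSemidef.nonneg
  have hsymm : (CFC.sqrt S)ᵀ = CFC.sqrt S := by
    have := (CFC.sqrt_nonneg S).isSelfAdjoint.star_eq
    rwa [star_eq_conjTranspose, conjTranspose_eq_transpose_of_trivial] at this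
  refine ⟨CFC.sqrt S, by rw [hsymm, h], ?_⟩
  have hdet := hS.det_pos.ne'
  rw [← h, det_mul] at hdet
  exact isUnit_iff_ne_zero.2 (left_ne_zero_of_mul hdet)

theorem mulVec_dotProduct_inv_mulVec {B : Matrix (Fin p) (Fin p) ℝ} (hB : B * Bᵀ = S)
    (hdet : IsUnit B.det) (v : Fin p → ℝ) : (B *ᵥ v) ⬝ᵥ (S⁻¹ *ᵥ (B *ᵥ v)) = v ⬝ᵥ v := by
  have hdet' : IsUnit Bᵀ.det := by rwa [det_transpose]
  have h : Bᵀ * (S⁻¹ * B) = 1 := by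
    rw [← hB, Matrix.mul_inv_rev, Matrix.mul_assoc, nonsing_inv_mul _ hdet, Matrix.mul_one,
      mul_nonsing_inv _ hdet']
  rw [mulVec_mulVec, dotProduct_comm, dotProduct_mulVec, ← mulVec_transpose, mulVec_mulVec, h,
    one_mulVec]

end Sqrt

/-! ### Reduction to a spherical density. -/

section Standardisation

variable {n p : ℕ} (B : Matrix (Fin p) (Fin p) ℝ)

/-- The linear equivalence applying an invertible matrix to each of `n` vectors. -/
def blockEquiv (n : ℕ) (hB : IsUnit B.det) :
    EuclideanSpace ℝ (Fin n × Fin p) ≃ₗ[ℝ] (Fin n → Fin p → ℝ) where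
  toFun z i := B *ᵥ fun a => z (i, a)
  map_add' z w := funext fun i => mulVec_add B (fun a => z (i, a)) fun a => w (i, a)
  map_smul' r z := funext fun i => mulVec_smul B r fun a => z (i, a)
  invFun x := WithLp.toLp 2 fun t => (B⁻¹ *ᵥ x t.1) t.2
  left_inv z := by
    ext t
    simp [mulVec_mulVec, nonsing_inv_mul _ hB]
  right_inv x := by
    ext i a
    simp [mulVec_mulVec, mul_nonsing_inv _ hB]

theorem blockEquiv_apply (hB : IsUnit B.det) (z : EuclideanSpace ℝ (Fin n × Fin p)) (i : Fin n) :
    blockEquiv B n hB z i = B *ᵥ fun a => z (i, a) := rfl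

theorem withDensity_map {α β : Type*} [MeasurableSpace α] [MeasurableSpace β] (μ : Measure α)
    {f : α → β} (hf : Measurable f) {g : β → ENNReal} (hg : Measurable g) :
    (μ.map f).withDensity g = (μ.withDensity (g ∘ f)).map f := by
  ext s hs
  rw [withDensity_apply _ hs, setLIntegral_map hs hg hf, Measure.map_apply hf hs,
    withDensity_apply _ (hf hs)]
  rfl

/-- The normalising constant of `kotzGenerator`. -/
def kotzConst (N : ℕ) (q θ s : ℝ) : ℝ :=
  s * θ ^ ((2 * q + N - 2) / (2 * s)) * Real.Gamma ((N : ℝ) / 2) /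
      (Real.pi ^ ((N : ℝ) / 2) * Real.Gamma ((2 * q + N - 2) / (2 * s)))

theorem kotzConst_nonneg {N : ℕ} {q θ s : ℝ} (hθ : 0 < θ) (hs : 0 < s) (hq : 2 < 2 * q + N) :
    0 ≤ kotzConst N q θ s := by
  have h1 : 0 ≤ (2 * q + N - 2) / (2 * s) := by
    apply div_nonneg <;> linarith
  have h2 := Real.Gamma_nonneg_of_nonneg h1
  have h3 : 0 ≤ Real.Gamma ((N : ℝ) / 2) := Real.Gamma_nonneg_of_nonneg (by positivity)
  unfold kotzConst
  positivity

theorem measurable_kotzDensity (q θ s : ℝ) (m : Fin p → ℝ) (S : Matrix (Fin p) (Fin p) ℝ) :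
    Measurable (kotzDensity n p q θ s m S) := by
  have hk : Measurable (kotzGenerator (n * p) q θ s) :=
    (measurable_kotzKernel q θ s).const_mul _
  refine (hk.comp ?_).const_mul _
  simp only [dotProduct, mulVec, Pi.sub_apply]
  fun_prop

/-- The Kotz model is an affine image of a spherical Kotz type distribution. -/
theorem exists_kotzModel_eq_map {q θ s : ℝ} (hθ : 0 < θ) (hs : 0 < s)
    (hq : 2 < 2 * q + (n : ℝ) * p) (m : Fin p → ℝ) {S : Matrix (Fin p) (Fin p) ℝ} (hS : S.PosDef)
    (hBS : B * Bᵀ = S) (hB : IsUnit B.det) :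
    ∃ C : ℝ, 0 ≤ C ∧ kotzModel n p q θ s m S =
      ((volume : Measure (EuclideanSpace ℝ (Fin n × Fin p))).withDensity fun z =>
        ENNReal.ofReal (C * kotzKernel q θ s (‖z‖ ^ 2))).map
          fun z => (fun _ => m) + blockEquiv B n hB z := by
  set φ := (blockEquiv B n hB).toContinuousLinearEquiv with hφ
  have := φ.isAddHaarMeasure_map (volume : Measure (EuclideanSpace ℝ (Fin n × Fin p)))
  -- By uniqueness of Haar measure the Jacobian is some finite constant c, whose value is never
  -- needed.
  obtain ⟨c, hc, hvol⟩ : ∃ c : ENNReal, c ≠ ⊤ ∧ (volume : Measure (Fin n → Fin p → ℝ)) =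
      c • (volume : Measure (EuclideanSpace ℝ (Fin n × Fin p))).map φ :=
    ⟨_, ENNReal.coe_ne_top, Measure.isAddLeftInvariant_eq_smul _ _⟩
  set K : ℝ := S.det ^ (-((n : ℝ) / 2)) * kotzConst (n * p) q θ s with hK
  have hK0 : 0 ≤ K := mul_nonneg (Real.rpow_nonneg hS.det_pos.le _)
    (kotzConst_nonneg hθ hs (by push_cast; exact hq))
  have hφm : Measurable φ := φ.continuous.measurable
  have hψm : Measurable fun z : EuclideanSpace ℝ (Fin n × Fin p) => (fun _ : Fin n => m) + φ z :=
    hφm.const_add _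
  have hvol' : (volume : Measure (Fin n → Fin p → ℝ)) =
      c • (volume : Measure (EuclideanSpace ℝ (Fin n × Fin p))).map
        fun z => (fun _ : Fin n => m) + φ z := by
    conv_lhs => rw [← map_add_left_eq_self volume (fun _ : Fin n => m), hvol]
    rw [Measure.map_smul, Measure.map_map (measurable_const_add _) hφm]
    rfl
  have hnorm : ∀ z : EuclideanSpace ℝ (Fin n × Fin p),
      ∑ i, (((fun _ : Fin n => m) + φ z) i - m) ⬝ᵥ
        (S⁻¹ *ᵥ (((fun _ : Fin n => m) + φ z) i - m)) = ‖z‖ ^ 2 := fun z => by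
    have : ∀ i, ((fun _ : Fin n => m) + φ z) i - m = B *ᵥ fun a => z (i, a) := fun i => by
      rw [Pi.add_apply, add_sub_cancel_left]
      rfl
    simp_rw [this, mulVec_dotProduct_inv_mulVec hBS hB]
    rw [EuclideanSpace.real_norm_sq_eq, Fintype.sum_prod_type]
    simp [dotProduct, sq]
  refine ⟨c.toReal * K, mul_nonneg ENNReal.toReal_nonneg hK0, ?_⟩
  have hmeas : Measurable fun x : Fin n → Fin p → ℝ =>
      ENNReal.ofReal (kotzDensity n p q θ s m S x) :=
    (measurable_kotzDensity q θ s m S).ennreal_ofReal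
  rw [kotzModel, hvol', withDensity_smul_measure, withDensity_map _ hψm hmeas,
    ← Measure.map_smul, ← withDensity_smul' _ _ hc]
  congr 2
  ext z
  have hd : kotzDensity n p q θ s m S ((fun _ : Fin n => m) + φ z) =
      K * kotzKernel q θ s (‖z‖ ^ 2) := by
    rw [kotzDensity, hnorm, hK, mul_assoc]
    rfl
  simp only [Pi.smul_apply, Function.comp_apply, smul_eq_mul]
  rw [hd, mul_assoc c.toReal, ENNReal.ofReal_mul ENNReal.toReal_nonneg, ENNReal.ofReal_toReal hc]

end Standardisation

/-! ### Deviations from the mean as linear forms. -/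

section CentredRows

variable {n p : ℕ} (B : Matrix (Fin p) (Fin p) ℝ)

/-- The coefficients of the centred rows as linear forms of the standardised sample. -/
def centredCoeff (n : ℕ) (i : Fin n) (a : Fin p) : EuclideanSpace ℝ (Fin n × Fin p) :=
  WithLp.toLp 2 fun t => centering n i t.1 * B a t.2

/-- The deviations from the sample mean as linear forms of the standardised sample. -/
def centredRow (n : ℕ) (i : Fin n) (a : Fin p) (z : EuclideanSpace ℝ (Fin n × Fin p)) : ℝ :=
  inner ℝ (centredCoeff B n i a) z

theorem sspMatrix_blockEquiv (hn : n ≠ 0) (hB : IsUnit B.det) (m : Fin p → ℝ)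
    (z : EuclideanSpace ℝ (Fin n × Fin p)) :
    sspMatrix ((fun _ => m) + blockEquiv B n hB z) = gramSum (centredRow B n) z := by
  have h : ∀ i a, ∑ k, centering n i k * ((fun _ : Fin n => m) + blockEquiv B n hB z) k a =
      centredRow B n i a z := fun i a => by
    simp only [Pi.add_apply, mul_add, Finset.sum_add_distrib, ← Finset.sum_mul,
      sum_centering hn, zero_mul, zero_add, centredRow, centredCoeff, PiLp.inner_apply,
      Fintype.sum_prod_type, blockEquiv_apply, mulVec, dotProduct, Finset.mul_sum]
    refine Finset.sum_congr rfl fun k _ => Finset.sum_congr rfl fun b _ => ?_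
    simp
    ring
  rw [sspMatrix_eq_gramSum]
  simp only [gramSum, h]

theorem hasGaussianLaw_centredRow :
    HasGaussianLaw (fun z => fun t : Fin n × Fin p => centredRow B n t.1 t.2 z)
      (stdGaussian (EuclideanSpace ℝ (Fin n × Fin p))) :=
  (IsGaussian.hasGaussianLaw_id (μ := stdGaussian (EuclideanSpace ℝ (Fin n × Fin p)))).map_fun
    (ContinuousLinearMap.pi fun t : Fin n × Fin p => innerSL ℝ (centredCoeff B n t.1 t.2))

theorem integral_centredRow (i : Fin n) (a : Fin p) :
    ∫ z, centredRow B n i a z ∂stdGaussian (EuclideanSpace ℝ (Fin n × Fin p)) = 0 :=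
  integral_strongDual_stdGaussian (innerSL ℝ (centredCoeff B n i a))

theorem integral_centredRow_mul (hn : n ≠ 0) {S : Matrix (Fin p) (Fin p) ℝ} (hBS : B * Bᵀ = S)
    (i j : Fin n) (a b : Fin p) :
    ∫ z, centredRow B n i a z * centredRow B n j b z
      ∂stdGaussian (EuclideanSpace ℝ (Fin n × Fin p)) = centering n i j * S a b := by
  have hcov := covarianceBilin_apply_eq_cov
    (IsGaussian.memLp_two_id (μ := stdGaussian (EuclideanSpace ℝ (Fin n × Fin p))))
    (centredCoeff B n i a) (centredCoeff B n j b)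
  rw [covarianceBilin_stdGaussian, covariance] at hcov
  have h0 := integral_centredRow (n := n) B
  simp only [centredRow] at h0 ⊢
  simp only [h0, sub_zero] at hcov
  -- Writing the centring matrix as its own square, and S as BBᵀ, makes the right side the inner
  -- product of the coefficient vectors.
  rw [← hcov, innerSL_apply_apply, ← centering_mul_self hn, ← hBS, Matrix.mul_apply,
    Matrix.mul_apply, Finset.sum_mul_sum]
  simp only [centredCoeff, PiLp.inner_apply, Fintype.sum_prod_type]
  refine Finset.sum_congr rfl fun k _ => Finset.sum_congr rfl fun c _ => ?_
  have : centering n k j = centering n j k := by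
    conv_rhs => rw [← centering_transpose, transpose_apply]
  simp [this]
  ring

theorem centredRow_smul (r : ℝ) (z : EuclideanSpace ℝ (Fin n × Fin p)) (i : Fin n) (a : Fin p) :
    centredRow B n i a (r • z) = r * centredRow B n i a z :=
  real_inner_smul_right _ _ _

theorem continuous_centredRow (i : Fin n) (a : Fin p) : Continuous (centredRow B n i a) := by
  unfold centredRow
  fun_prop

theorem gramSum_centredRow_smul (r : ℝ) (z : EuclideanSpace ℝ (Fin n × Fin p)) :
    gramSum (centredRow B n) (r • z) = r ^ 2 • gramSum (centredRow B n) z := by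
  ext a b
  rw [Matrix.smul_apply, gramSum_apply, gramSum_apply, smul_eq_mul, Finset.mul_sum]
  refine Finset.sum_congr rfl fun i _ => ?_
  rw [centredRow_smul, centredRow_smul]
  ring

theorem continuous_gramSum_centredRow (a b : Fin p) :
    Continuous fun z => gramSum (centredRow B n) z a b := by
  simp_rw [gramSum_apply]
  exact continuous_finsetSum _ fun i _ =>
    (continuous_centredRow B i a).mul (continuous_centredRow B i b)

theorem continuous_gramSum_centredRow_sq (a b : Fin p) :
    Continuous fun z => (gramSum (centredRow B n) z ^ 2) a b := by
  simp_rw [sq, Matrix.mul_apply]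
  exact continuous_finsetSum _ fun c _ =>
    (continuous_gramSum_centredRow B a c).mul (continuous_gramSum_centredRow B c b)

end CentredRows

/-! ### Comparison of radial moments. -/

section Comparison

theorem radialMoment_add_div {q θ s d : ℝ} (hθ : 0 < θ) (hs : 0 < s) (k : ℝ) :
    radialMoment q θ s (d + k) / radialMoment q θ s d =
      θ ^ (-(k / 2) / s) * Real.Gamma ((2 * q + d + k - 2) / (2 * s)) /
        Real.Gamma ((2 * q + d - 2) / (2 * s)) := by
  have h : θ ^ (-(2 * q + (d + k) - 2) / (2 * s)) =
      θ ^ (-(k / 2) / s) * θ ^ (-(2 * q + d - 2) / (2 * s)) := by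
    rw [← Real.rpow_add hθ]
    congr 1
    field_simp
    ring
  have hpos : θ ^ (-(2 * q + d - 2) / (2 * s)) ≠ 0 := (Real.rpow_pos_of_pos hθ _).ne'
  rw [radialMoment, radialMoment, h, show 2 * q + (d + k) - 2 = 2 * q + d + k - 2 by ring]
  field_simp

/-- The quotient is E|z|² for a standard Gaussian in dimension d; it follows from Γ(x+1) = xΓ(x) at
x = d/2. -/
theorem radialMoment_gaussian_two {d : ℝ} (hd : 0 < d) :
    radialMoment 1 (1 / 2) 1 (d + 2) / radialMoment 1 (1 / 2) 1 d = d := by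
  have hΓ := (Real.Gamma_pos_of_pos (half_pos hd)).ne'
  rw [radialMoment_add_div (by norm_num) one_pos,
    show (2 * 1 + d + 2 - 2) / (2 * 1) = d / 2 + 1 by ring,
    show (2 * 1 + d - 2) / (2 * 1) = d / 2 by ring, Real.Gamma_add_one (half_pos hd).ne',
    show (-(2 / 2) / 1 : ℝ) = -1 by norm_num, Real.rpow_neg_one]
  field_simp

/-- The quotient telescopes through d + 2, so the degree 2 case is used at d and at d + 2. -/
theorem radialMoment_gaussian_four {d : ℝ} (hd : 0 < d) :
    radialMoment 1 (1 / 2) 1 (d + 4) / radialMoment 1 (1 / 2) 1 d = d * (d + 2) := by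
  have h1 := radialMoment_gaussian_two hd
  have h2 := radialMoment_gaussian_two (d := d + 2) (by linarith)
  have h4 := (radialMoment_pos (q := 1) (θ := 1 / 2) (s := 1) (d := d + 2) (by norm_num) one_pos
    (by linarith)).ne'
  rw [show d + 2 + 2 = d + 4 by ring] at h2
  rw [← div_mul_div_cancel₀ h4, h1, h2, mul_comm]

variable {E : Type*} [NormedAddCommGroup E] [InnerProductSpace ℝ E] [FiniteDimensional ℝ E]
  [Nontrivial E] [MeasurableSpace E] [BorelSpace E]

/-- Moments of homogeneous functions under a spherical Kotz type distribution and under the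
standard Gaussian distribution are proportional. -/
theorem integral_kotz_eq_mul_integral_stdGaussian {q θ s C : ℝ} (hθ : 0 < θ) (hs : 0 < s)
    (hC : 0 ≤ C) (hq : 2 < 2 * q + Module.finrank ℝ E)
    (hprob : IsProbabilityMeasure ((volume : Measure E).withDensity
      fun z => ENNReal.ofReal (C * kotzKernel q θ s (‖z‖ ^ 2))))
    {F : E → ℝ} (hF : Continuous F) (k : ℕ) (hk : ∀ (r : ℝ) z, F (r • z) = r ^ k * F z) :
    Integrable F ((volume : Measure E).withDensity
        fun z => ENNReal.ofReal (C * kotzKernel q θ s (‖z‖ ^ 2))) ∧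
      ∫ z, F z ∂((volume : Measure E).withDensity
          fun z => ENNReal.ofReal (C * kotzKernel q θ s (‖z‖ ^ 2))) =
        radialMoment q θ s (Module.finrank ℝ E + k) / radialMoment q θ s (Module.finrank ℝ E) /
          (radialMoment 1 (1 / 2) 1 (Module.finrank ℝ E + k) /
            radialMoment 1 (1 / 2) 1 (Module.finrank ℝ E)) * ∫ z, F z ∂stdGaussian E := by
  have hd : (0 : ℝ) < Module.finrank ℝ E := by exact_mod_cast Module.finrank_pos
  have hk0 : (0 : ℝ) ≤ k := k.cast_nonneg
  obtain ⟨h1, h2⟩ := integral_homogeneous_of_kotz volume hθ hs hC hq hprob hF k hk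
  refine ⟨h1, ?_⟩
  have hG := stdGaussian_eq_withDensity E
  have hGprob := isProbabilityMeasure_stdGaussian (E := E)
  rw [hG] at hGprob
  have h3 := (integral_homogeneous_of_kotz volume (by norm_num) one_pos (by positivity)
    (by linarith) hGprob hF k hk).2
  rw [h2, hG, h3]
  have h4 := (radialMoment_pos (q := 1) (θ := 1 / 2) (s := 1) (d := Module.finrank ℝ E + k)
    (by norm_num) one_pos (by linarith)).ne'
  have h5 := (radialMoment_pos (q := 1) (θ := 1 / 2) (s := 1) (d := Module.finrank ℝ E)
    (by norm_num) one_pos (by linarith)).ne'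
  field_simp

end Comparison

/-! ### Assembly. -/

/-- The first two moments of a Kotz–Wishart matrix. -/
theorem moments_of_hasLaw_kotzWishart {Ω : Type*} [MeasurableSpace Ω] {P : Measure Ω}
    [IsProbabilityMeasure P] {n p : ℕ} (hp : 0 < p) (hn : 0 < n) {q θ s : ℝ} (hθ : 0 < θ)
    (hs : 0 < s) (hq : 2 < 2 * q + (n : ℝ) * p) {m : Fin p → ℝ} {S : Matrix (Fin p) (Fin p) ℝ}
    (hS : S.PosDef) {A : Ω → Matrix (Fin p) (Fin p) ℝ}
    (hA : HasLaw A (kotzWishart n p q θ s m S) P) :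
    IntegrableMatrix A P ∧
      expectation A P = (((n : ℝ) - 1) * θ ^ (-1 / s) * Real.Gamma ((2 * q + n * p) / (2 * s)) /
        (n * p * Real.Gamma ((2 * q + n * p - 2) / (2 * s)))) • S ∧
      IntegrableMatrix (fun ω => A ω ^ 2) P ∧
      expectation (fun ω => A ω ^ 2) P =
        (θ ^ (-2 / s) * Real.Gamma ((2 * q + n * p + 2) / (2 * s)) /
          (n * p * (n * p + 2) * Real.Gamma ((2 * q + n * p - 2) / (2 * s)))) •
          (((n : ℝ) - 1) ^ 2 • S ^ 2 + ((n : ℝ) - 1) • (S.trace • S + S ^ 2)) := by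
  obtain ⟨B, hBS, hB⟩ := exists_mul_transpose_eq hS
  obtain ⟨C, hC, hmodel⟩ := exists_kotzModel_eq_map (n := n) B hθ hs hq m hS hBS hB
  have hfin : (Module.finrank ℝ (EuclideanSpace ℝ (Fin n × Fin p)) : ℝ) = n * p := by simp
  set E := EuclideanSpace ℝ (Fin n × Fin p)
  set ν : Measure E := (volume : Measure E).withDensity fun z =>
    ENNReal.ofReal (C * kotzKernel q θ s (‖z‖ ^ 2)) with hν
  have hn0 : n ≠ 0 := hn.ne'
  have hnp : (0 : ℝ) < n * p := by positivity
  have : Nonempty (Fin n × Fin p) := ⟨(⟨0, hn⟩, ⟨0, hp⟩)⟩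
  have hψ : Measurable fun z : E => (fun _ : Fin n => m) + blockEquiv B n hB z :=
    ((blockEquiv B n hB).toContinuousLinearEquiv.continuous.measurable).const_add _
  have hT : Measurable (gramSum (centredRow B n)) :=
    measurable_pi_lambda _ fun a => measurable_pi_lambda _ fun b =>
      (continuous_gramSum_centredRow B a b).measurable
  have hA' : HasLaw A (ν.map (gramSum (centredRow B n))) P := by
    rw [kotzWishart, hmodel, Measure.map_map measurable_sspMatrix hψ] at hA
    convert! hA using 2
    exact funext fun z => (sspMatrix_blockEquiv B hn0 hB m z).symm
  -- Since A is a random matrix on a probability space, its law has mass 1, and so does ν; the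
  -- normalisation of the Kotz density need not be verified by integration.
  have hprob : IsProbabilityMeasure ν := by
    have h := hA'.isProbabilityMeasure_iff.1 inferInstance
    refine ⟨?_⟩
    have h1 := h.measure_univ
    rwa [Measure.map_apply hT MeasurableSet.univ, Set.preimage_univ] at h1
  have hqE : 2 < 2 * q + Module.finrank ℝ E := by rwa [hfin]
  have h1 := fun a b => integral_kotz_eq_mul_integral_stdGaussian hθ hs hC hqE hprob
    (continuous_gramSum_centredRow B a b) 2 fun r z => by
      rw [gramSum_centredRow_smul, Matrix.smul_apply, smul_eq_mul]
  have h2 := fun a b => integral_kotz_eq_mul_integral_stdGaussian hθ hs hC hqE hprob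
    (continuous_gramSum_centredRow_sq B a b) 4 fun r z => by
      rw [gramSum_centredRow_smul, smul_pow, Matrix.smul_apply, smul_eq_mul, ← pow_mul]
  have hG := hasGaussianLaw_centredRow (n := n) B
  have e1 := expectation_gramSum hG (integral_centredRow_mul B hn0 hBS)
  have e2 := expectation_gramSum_sq hG (integral_centredRow B) (integral_centredRow_mul B hn0 hBS)
  -- By symmetry and idempotence tr MᵀM = tr M = n - 1, which is where the Wishart formula with n -
  -- 1 degrees of freedom appears.
  rw [centering_transpose, centering_mul_self hn0, trace_centering hn0] at e2
  rw [trace_centering hn0] at e1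
  rw [hfin] at h1 h2
  push_cast at h1 h2
  rw [radialMoment_gaussian_two hnp, radialMoment_add_div hθ hs] at h1
  rw [radialMoment_gaussian_four hnp, radialMoment_add_div hθ hs] at h2
  refine ⟨integrableMatrix_of_hasLaw (G := id) hA' hT measurable_entry fun a b => (h1 a b).1, ?_,
    integrableMatrix_of_hasLaw (G := fun M => M ^ 2) hA' hT measurable_sq_entry
      fun a b => (h2 a b).1, ?_⟩
  · have h := expectation_of_hasLaw (G := id) hA' hT measurable_entry
    simp only [id_eq] at h
    rw [h]
    have h3 : expectation (fun z => gramSum (centredRow B n) z) ν =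
        (θ ^ (-(2 / 2) / s) * Real.Gamma ((2 * q + n * p + 2 - 2) / (2 * s)) /
          Real.Gamma ((2 * q + n * p - 2) / (2 * s)) / (n * p)) •
          expectation (gramSum (centredRow B n)) (stdGaussian E) :=
      Matrix.ext fun a b => (h1 a b).2
    rw [h3, e1, smul_smul]
    congr 1
    rw [add_sub_cancel_right, div_self two_ne_zero]
    field_simp
  · rw [expectation_of_hasLaw (G := fun M => M ^ 2) hA' hT measurable_sq_entry]
    have h3 : expectation (fun z => gramSum (centredRow B n) z ^ 2) ν =
        (θ ^ (-(4 / 2) / s) * Real.Gamma ((2 * q + n * p + 4 - 2) / (2 * s)) /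
          Real.Gamma ((2 * q + n * p - 2) / (2 * s)) / (n * p * (n * p + 2))) •
          expectation (fun z => gramSum (centredRow B n) z ^ 2) (stdGaussian E) :=
      Matrix.ext fun a b => (h2 a b).2
    rw [h3, e2]
    congr 1
    rw [show 2 * q + (n : ℝ) * p + 4 - 2 = 2 * q + n * p + 2 by ring,
      show -((4 : ℝ) / 2) = -2 by norm_num]
    field_simp

end KotzWishart

end

theorem mainTheorem7 {Ω : Type*} [MeasurableSpace Ω] (P : MeasureTheory.Measure Ω)
    [MeasureTheory.IsProbabilityMeasure P]
    (n p : ℕ) (hp : 0 < p) (hpn : p < n)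
    (q θ s : ℝ) (hθ : 0 < θ) (hs : 0 < s) (hq : 2 < 2 * q + (n : ℝ) * p)
    (m : Fin p → ℝ) (S : Matrix (Fin p) (Fin p) ℝ) (hS : S.PosDef)
    (A : Ω → Matrix (Fin p) (Fin p) ℝ)
    (hA : ProbabilityTheory.HasLaw A (KotzWishart.kotzWishart n p q θ s m S) P) :
    KotzWishart.IntegrableMatrix A P ∧
    KotzWishart.expectation A P =
      (((n : ℝ) - 1) * θ ^ (-1 / s) * Real.Gamma ((2 * q + n * p) / (2 * s)) /
        (n * p * Real.Gamma ((2 * q + n * p - 2) / (2 * s)))) • S ∧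
    KotzWishart.IntegrableMatrix (fun ω => A ω ^ 2) P ∧
    ∀ {Ω' : Type*} [MeasurableSpace Ω'] (P' : MeasureTheory.Measure Ω')
      [MeasureTheory.IsProbabilityMeasure P'] (W : Ω' → Matrix (Fin p) (Fin p) ℝ),
      ProbabilityTheory.HasLaw W (KotzWishart.wishart p (n - 1) S) P' →
      KotzWishart.IntegrableMatrix (fun ω => W ω ^ 2) P' ∧
      KotzWishart.expectation (fun ω => A ω ^ 2) P =
        (θ ^ (-2 / s) * Real.Gamma ((2 * q + n * p + 2) / (2 * s)) /
          (n * p * (n * p + 2) * Real.Gamma ((2 * q + n * p - 2) / (2 * s)))) •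
          KotzWishart.expectation (fun ω => W ω ^ 2) P' ∧
      KotzWishart.expectation (fun ω => W ω ^ 2) P' =
        ((n : ℝ) - 1) ^ 2 • S ^ 2 + ((n : ℝ) - 1) • (S.trace • S + S ^ 2) := by
  obtain ⟨h1, h2, h3, h4⟩ :=
    KotzWishart.moments_of_hasLaw_kotzWishart hp (hp.trans hpn) hθ hs hq hS hA
  refine ⟨h1, h2, h3, fun P' _ W hW => ?_⟩
  obtain ⟨h5, h6⟩ := KotzWishart.moments_of_hasLaw_wishart hS.posSemidef hW
  rw [Nat.cast_pred (hp.trans hpn)] at h6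
  exact ⟨h5, by rw [h4, h6], h6⟩
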